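/- An arrangement of orthogonal circles is a finite set $\mathcal{A}$ of circles (of positive radius) in the Euclidean plane such that any two distinct circles of $\mathcal{A}$ that intersect do so at a right angle, that is, at each of their common points their tangent lines are perpendicular. An intersection point of $\mathcal{A}$ is a point that lies on at least two circles of $\mathcal{A}$, and a face of $\mathcal{A}$ is a connected component of $\mathbb{R}^2 \setminus \bigcup \mathcal{A}$. Theorem. Every arrangement of $n$ orthogonal circles has at most $14n$ intersection points and at most $15n+2$ faces. -/

import Mathlib

namespace OrthogonalCircles

/-- The Euclidean plane. -/
abbrev Plane : Type := EuclideanSpace ℝ (Fin 2)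

/-- A (possibly degenerate) circle in the plane, given by its center and its radius; that the radius
is positive is required in `IsOrthogonalArrangement`. -/
abbrev PlaneCircle : Type := EuclideanGeometry.Sphere Plane

/-- The tangent line of the circle `α` at one of its points `p`: the line through `p` that is
perpendicular to the radius vector. -/
noncomputable def tangentLine (α : PlaneCircle) (p : Plane) : AffineSubspace ℝ Plane :=
  α.orthRadius p

/-- The circles `α` and `β` meet only at right angles: at each common point, their two tangent
lines are perpendicular. (There may be no common point.) -/
def MeetAtRightAngles (α β : PlaneCircle) : Prop :=
  ∀ p : Plane, p ∈ α → p ∈ β → (tangentLine α p).direction ⟂ (tangentLine β p).direction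

/-- An arrangement of orthogonal circles: a finite collection of (proper) circles in which any two
distinct circles that intersect do so at right angles. -/
def IsOrthogonalArrangement (A : Finset PlaneCircle) : Prop :=
  (∀ α ∈ A, 0 < α.radius) ∧ ∀ α ∈ A, ∀ β ∈ A, α ≠ β → MeetAtRightAngles α β

/-- The intersection points of the arrangement: the points on at least two of its circles. -/
def intersectionPoints (A : Finset PlaneCircle) : Set Plane :=
  {p | ∃ α ∈ A, ∃ β ∈ A, α ≠ β ∧ p ∈ α ∧ p ∈ β}

/-- The complement in the plane of the union of the circles of the arrangement. -/
def complementOfCircles (A : Finset PlaneCircle) : Set Plane :=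
  {p | ∀ α ∈ A, p ∉ α}

/-- The faces of the arrangement: the connected components of the complement of the union of its
circles. -/
def faces (A : Finset PlaneCircle) : Set (Set Plane) :=
  {F | ∃ x ∈ complementOfCircles A, F = connectedComponentIn (complementOfCircles A) x}

end OrthogonalCircles

namespace OrthogonalCircles

open Real Filter Topology

/-! Both bounds follow by induction on the number of circles from one fact,
`IsOrthogonalArrangement.exists_card_orth_le`: some circle `C` meets at most seven others. Two
circles meeting at a right angle share at most two points, so `C` carries at most 14 intersection
points, which cut it into at most 15 arcs.

To find `C`, suppose first that no circle contains another, and take a smallest one. Seen from its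
center, the centers of any two orthogonal neighbors are at least π/3 apart, so there are at most
six. Otherwise take a smallest circle `α` that contains another, and a smallest `C` inside `α`.
Neighbors of `C` inside `α` are again unnested and not smaller than `C`, hence at most six
(`IsFlower.card_le_six`). Any other neighbor crosses `α`, so it is orthogonal to both `C` and `α`;
at most two such circles exist (`card_orth_orth_le_two`), and the presence of one lowers six to five
(`IsFlower.card_le_five`). Thus there are at most 6 + 0 or 5 + 2.

Faces are counted by linear algebra instead of Euler's formula: components of an open set have
independent indicators in its space `locConst` of locally constant functions. Removing a circle adds
at most one dimension per arc, namely the jump across that arc (`rank_locConst_diff_sphere_le`).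
Starting from the plane, with dimension at most 1, this gives at most 15n + 1. -/

/-! ### Relative positions of two circles -/

/-- The squared distance of the centers is the sum of the squared radii. -/
def Orth (α β : PlaneCircle) : Prop :=
  dist α.center β.center ^ 2 = α.radius ^ 2 + β.radius ^ 2

/-- Each of the two circles lies outside the other. -/
def Apart (α β : PlaneCircle) : Prop :=
  α.radius + β.radius < dist α.center β.center

/-- The circle `α` lies strictly inside `β`. -/
def Inside (α β : PlaneCircle) : Prop :=
  dist α.center β.center < β.radius - α.radius

theorem dist_sq_eq (p q : Plane) : dist p q ^ 2 = (p 0 - q 0) ^ 2 + (p 1 - q 1) ^ 2 := by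
  rw [EuclideanSpace.dist_eq, sq_sqrt (by positivity), Fin.sum_univ_two, Real.dist_eq, Real.dist_eq,
    sq_abs, sq_abs]

theorem mem_circle_iff {α : PlaneCircle} (hα : 0 < α.radius) {p : Plane} :
    p ∈ α ↔ (p 0 - α.center 0) ^ 2 + (p 1 - α.center 1) ^ 2 = α.radius ^ 2 := by
  rw [EuclideanGeometry.mem_sphere, ← dist_sq_eq, sq_eq_sq₀ dist_nonneg hα.le]

theorem Orth.symm {α β : PlaneCircle} (h : Orth α β) : Orth β α := by
  unfold Orth at *
  rw [dist_comm, h, add_comm]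

theorem Apart.symm {α β : PlaneCircle} (h : Apart α β) : Apart β α := by
  unfold Apart at *
  rwa [dist_comm, add_comm]

theorem orth_of_mem {α β : PlaneCircle} (h : MeetAtRightAngles α β) {p : Plane}
    (hpα : p ∈ α) (hpβ : p ∈ β) : Orth α β := by
  have key := h p hpα hpβ
  unfold tangentLine at key
  rw [EuclideanGeometry.Sphere.direction_orthRadius,
    EuclideanGeometry.Sphere.direction_orthRadius, Submodule.isOrtho_iff_inner_eq] at key
  -- The tangent directions are the radius vectors turned by a right angle, so the radius vectors at
  -- `p` are perpendicular and Pythagoras applies.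
  have := key !₂[-(p 1 - α.center 1), p 0 - α.center 0] (by
      rw [Submodule.mem_orthogonal_singleton_iff_inner_right]
      simp [PiLp.inner_apply, Fin.sum_univ_two]; ring)
    !₂[-(p 1 - β.center 1), p 0 - β.center 0] (by
      rw [Submodule.mem_orthogonal_singleton_iff_inner_right]
      simp [PiLp.inner_apply, Fin.sum_univ_two]; ring)
  simp only [PiLp.inner_apply, Fin.sum_univ_two] at this
  simp at this
  have h1 : dist p α.center ^ 2 = α.radius ^ 2 := by rw [EuclideanGeometry.mem_sphere.1 hpα]
  have h2 : dist p β.center ^ 2 = β.radius ^ 2 := by rw [EuclideanGeometry.mem_sphere.1 hpβ]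
  rw [dist_sq_eq] at h1 h2
  unfold Orth
  rw [dist_sq_eq]
  linarith

theorem exists_mem_mem {α β : PlaneCircle} (hα : 0 < α.radius) (hβ : 0 < β.radius)
    (hne : α.center ≠ β.center) (h1 : ¬ Apart α β) (h2 : ¬ Inside α β) (h3 : ¬ Inside β α) :
    ∃ p, p ∈ α ∧ p ∈ β := by
  unfold Apart at h1
  unfold Inside at h2 h3
  rw [dist_comm β.center] at h3
  have hd : 0 < dist α.center β.center := dist_pos.2 hne
  have hsq := dist_sq_eq α.center β.center
  set d := dist α.center β.center
  set r := α.radius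
  set R := β.radius
  push Not at h1 h2 h3
  -- Heron's product: sixteen times the squared area of the triangle with sides `d`, `r`, `R`.
  -- Below, `a` is the signed distance from the center of `α` to the common chord, `k` half the
  -- chord, and `(e, f)` the unit vector between the centers.
  have hpos : 0 ≤ (R ^ 2 - (d - r) ^ 2) * ((d + r) ^ 2 - R ^ 2) := by
    apply mul_nonneg
    · nlinarith
    · nlinarith
  obtain ⟨a, ha⟩ : ∃ a, a = (d ^ 2 + r ^ 2 - R ^ 2) / (2 * d) := ⟨_, rfl⟩
  have ha' : 2 * d * a = d ^ 2 + r ^ 2 - R ^ 2 := by rw [ha]; field_simp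
  have hh : 0 ≤ r ^ 2 - a ^ 2 := by
    have : 0 ≤ (4 * d ^ 2) * (r ^ 2 - a ^ 2) := by
      have e : (4 * d ^ 2) * (r ^ 2 - a ^ 2) = 4 * d ^ 2 * r ^ 2 - (2 * d * a) ^ 2 := by ring
      rw [e, ha']
      calc _ ≤ _ := hpos
        _ = _ := by ring
    exact nonneg_of_mul_nonneg_right this (by positivity)
  obtain ⟨k, hk⟩ : ∃ k, k = √(r ^ 2 - a ^ 2) := ⟨_, rfl⟩
  have hk2 : k ^ 2 = r ^ 2 - a ^ 2 := by rw [hk, sq_sqrt hh]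
  obtain ⟨e, he⟩ : ∃ e, e = (β.center 0 - α.center 0) / d := ⟨_, rfl⟩
  obtain ⟨f, hf⟩ : ∃ f, f = (β.center 1 - α.center 1) / d := ⟨_, rfl⟩
  have he' : β.center 0 = α.center 0 + d * e := by rw [he]; field_simp; ring
  have hf' : β.center 1 = α.center 1 + d * f := by rw [hf]; field_simp; ring
  have hef : e ^ 2 + f ^ 2 = 1 := by
    rw [he', hf'] at hsq
    have : d ^ 2 * (e ^ 2 + f ^ 2) = d ^ 2 * 1 := by linarith
    exact mul_left_cancel₀ (by positivity) this
  refine ⟨!₂[α.center 0 + a * e - k * f, α.center 1 + a * f + k * e], ?_, ?_⟩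
  · rw [mem_circle_iff hα]
    simp
    linear_combination (a ^ 2 + k ^ 2) * hef + hk2
  · rw [mem_circle_iff hβ, he', hf']
    simp
    linear_combination ((a - d) ^ 2 + k ^ 2) * hef + hk2 - ha'

/-- The inequalities in `Apart` and `Inside` are strict, so tangency is among the cases where a
common point exists; a common point forces orthogonality. -/
theorem IsOrthogonalArrangement.trichotomy {A : Finset PlaneCircle}
    (hA : IsOrthogonalArrangement A) {α β : PlaneCircle} (hα : α ∈ A) (hβ : β ∈ A) (hne : α ≠ β) :
    Orth α β ∨ Apart α β ∨ Inside α β ∨ Inside β α := by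
  by_contra! hcon
  obtain ⟨h0, h1, h2, h3⟩ := hcon
  by_cases hc : α.center = β.center
  · unfold Inside at h2 h3
    rw [hc, dist_self] at h2 h3
    exact hne (EuclideanGeometry.Sphere.ext hc (by linarith))
  · obtain ⟨p, hp, hq⟩ := exists_mem_mem (hA.1 α hα) (hA.1 β hβ) hc h1 h2 h3
    exact h0 (orth_of_mem (hA.2 α hα β hβ hne) hp hq)

/-! ### Circles orthogonal to `C` in polar coordinates -/

theorem exists_polar (φ : ℝ) {r ρ x y : ℝ} (hr : 0 < r) (hρ : 0 < ρ)
    (h : x ^ 2 + y ^ 2 = r ^ 2 + ρ ^ 2) :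
    ∃ θ t d, -π < θ ∧ θ ≤ π ∧ 0 < t ∧ t < π / 2 ∧ 0 < d ∧ r = d * cos t ∧ ρ = d * sin t ∧
      x = d * cos (θ + φ) ∧ y = d * sin (θ + φ) := by
  -- `z` is `x + iy` turned by `-φ`; `w = r + iρ` below has the same modulus and lies in the open
  -- first quadrant, and its argument is `t`.
  set z : ℂ := ⟨x * cos φ + y * sin φ, -x * sin φ + y * cos φ⟩ with hz
  have hd2 : ‖z‖ ^ 2 = r ^ 2 + ρ ^ 2 := by
    rw [← Complex.normSq_eq_norm_sq, Complex.normSq_apply, ← h]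
    simp only [hz]
    linear_combination (x ^ 2 + y ^ 2) * sin_sq_add_cos_sq φ
  have hd : 0 < ‖z‖ := by
    rcases (norm_nonneg z).eq_or_lt with h0 | h0
    · rw [← h0] at hd2; nlinarith [pow_pos hr 2, pow_pos hρ 2]
    · exact h0
  set w : ℂ := ⟨r, ρ⟩ with hw
  have hwn : ‖w‖ = ‖z‖ := by
    rw [← sq_eq_sq₀ (norm_nonneg _) (norm_nonneg _), hd2, ← Complex.normSq_eq_norm_sq,
      Complex.normSq_apply]
    ring
  have hre := Complex.norm_mul_cos_arg z
  have him := Complex.norm_mul_sin_arg z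
  have hre' := Complex.norm_mul_cos_arg w
  have him' := Complex.norm_mul_sin_arg w
  rw [hwn] at hre' him'
  refine ⟨z.arg, w.arg, ‖z‖, Complex.neg_pi_lt_arg z, Complex.arg_le_pi z, ?_, ?_, hd, hre'.symm,
    him'.symm, ?_, ?_⟩
  · by_contra! hneg
    have : sin w.arg ≤ 0 := sin_nonpos_of_nonpos_of_neg_pi_le hneg (Complex.neg_pi_lt_arg w).le
    have : ‖z‖ * sin w.arg ≤ 0 := mul_nonpos_of_nonneg_of_nonpos hd.le this
    rw [him'] at this
    exact absurd hρ (not_lt.2 this)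
  · have := Complex.arg_lt_pi_div_two_iff.2 (Or.inl hr : 0 < w.re ∨ w.im < 0 ∨ w = 0)
    exact this
  · rw [cos_add]
    have e1 : z.re = x * cos φ + y * sin φ := rfl
    have e2 : z.im = -x * sin φ + y * cos φ := rfl
    rw [e1] at hre
    rw [e2] at him
    linear_combination -cos φ * hre + sin φ * him - x * sin_sq_add_cos_sq φ
  · rw [sin_add]
    have e1 : z.re = x * cos φ + y * sin φ := rfl
    have e2 : z.im = -x * sin φ + y * cos φ := rfl
    rw [e1] at hre
    rw [e2] at him
    linear_combination -sin φ * hre - cos φ * him - y * sin_sq_add_cos_sq φ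

section Pair

variable {r ρ₁ ρ₂ d₁ d₂ ψ₁ ψ₂ t₁ t₂ D : ℝ}

/-- Law of cosines with `d₁² - ρ₁² = d₂² - ρ₂² = r²`: the common `r²` equals `d₁ d₂ cos t₁ cos t₂`.
The next two lemmas add or subtract `ρ₁ ρ₂ = d₁ d₂ sin t₁ sin t₂`, which turns the product of
cosines into the cosine of a sum or difference. -/
theorem cos_sub_eq_of_orth (hd₁ : 0 < d₁) (hd₂ : 0 < d₂) (hr₁ : r = d₁ * cos t₁)
    (hr₂ : r = d₂ * cos t₂) (hρ₁ : ρ₁ = d₁ * sin t₁) (hρ₂ : ρ₂ = d₂ * sin t₂)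
    (hD : D ^ 2 = d₁ ^ 2 + d₂ ^ 2 - 2 * d₁ * d₂ * cos (ψ₁ - ψ₂)) (h : D ^ 2 = ρ₁ ^ 2 + ρ₂ ^ 2) :
    cos (ψ₁ - ψ₂) = cos t₁ * cos t₂ := by
  have : (2 * d₁ * d₂) * cos (ψ₁ - ψ₂) = (2 * d₁ * d₂) * (cos t₁ * cos t₂) := by
    have e₁ := sin_sq_add_cos_sq t₁
    have e₂ := sin_sq_add_cos_sq t₂
    have e₃ : r * r = (d₁ * cos t₁) * (d₂ * cos t₂) := by rw [← hr₁, ← hr₂]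
    have e₄ : r * r = (d₁ * cos t₁) * (d₁ * cos t₁) := by rw [← hr₁]
    have e₅ : r * r = (d₂ * cos t₂) * (d₂ * cos t₂) := by rw [← hr₂]
    rw [hρ₁, hρ₂] at h
    linear_combination hD - h - d₁ ^ 2 * e₁ - d₂ ^ 2 * e₂ + 2 * e₃ - e₄ - e₅
  exact mul_left_cancel₀ (by positivity) this

theorem cos_sub_lt_of_apart (hd₁ : 0 < d₁) (hd₂ : 0 < d₂) (hr₁ : r = d₁ * cos t₁)
    (hr₂ : r = d₂ * cos t₂) (hρ₁ : ρ₁ = d₁ * sin t₁) (hρ₂ : ρ₂ = d₂ * sin t₂)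
    (hp₁ : 0 < ρ₁) (hp₂ : 0 < ρ₂)
    (hD : D ^ 2 = d₁ ^ 2 + d₂ ^ 2 - 2 * d₁ * d₂ * cos (ψ₁ - ψ₂)) (h : ρ₁ + ρ₂ < D) :
    cos (ψ₁ - ψ₂) < cos (t₁ + t₂) := by
  have h' : (ρ₁ + ρ₂) ^ 2 < D ^ 2 := by gcongr
  have : (2 * d₁ * d₂) * cos (ψ₁ - ψ₂) < (2 * d₁ * d₂) * cos (t₁ + t₂) := by
    have e₁ := sin_sq_add_cos_sq t₁
    have e₂ := sin_sq_add_cos_sq t₂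
    have e₃ : r * r = (d₁ * cos t₁) * (d₂ * cos t₂) := by rw [← hr₁, ← hr₂]
    have e₄ : r * r = (d₁ * cos t₁) * (d₁ * cos t₁) := by rw [← hr₁]
    have e₅ : r * r = (d₂ * cos t₂) * (d₂ * cos t₂) := by rw [← hr₂]
    rw [hρ₁, hρ₂] at h'
    rw [cos_add]
    linear_combination h' + hD - d₁ ^ 2 * e₁ - d₂ ^ 2 * e₂ + 2 * e₃ - e₄ - e₅
  exact lt_of_mul_lt_mul_left this (by positivity)

theorem lt_cos_sub_of_inside (hd₁ : 0 < d₁) (hd₂ : 0 < d₂) (hr₁ : r = d₁ * cos t₁)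
    (hr₂ : r = d₂ * cos t₂) (hρ₁ : ρ₁ = d₁ * sin t₁) (hρ₂ : ρ₂ = d₂ * sin t₂) (hD0 : 0 ≤ D)
    (hD : D ^ 2 = d₁ ^ 2 + d₂ ^ 2 - 2 * d₁ * d₂ * cos (ψ₁ - ψ₂)) (h : D < ρ₂ - ρ₁) :
    cos (t₂ - t₁) < cos (ψ₁ - ψ₂) := by
  have h' : D ^ 2 < (ρ₂ - ρ₁) ^ 2 := by gcongr
  have : (2 * d₁ * d₂) * cos (t₂ - t₁) < (2 * d₁ * d₂) * cos (ψ₁ - ψ₂) := by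
    have e₁ := sin_sq_add_cos_sq t₁
    have e₂ := sin_sq_add_cos_sq t₂
    have e₃ : r * r = (d₁ * cos t₁) * (d₂ * cos t₂) := by rw [← hr₁, ← hr₂]
    have e₄ : r * r = (d₁ * cos t₁) * (d₁ * cos t₁) := by rw [← hr₁]
    have e₅ : r * r = (d₂ * cos t₂) * (d₂ * cos t₂) := by rw [← hr₂]
    rw [hρ₁, hρ₂] at h'
    rw [cos_sub]
    linear_combination h' - hD + d₁ ^ 2 * e₁ + d₂ ^ 2 * e₂ - 2 * e₃ + e₄ + e₅
  exact lt_of_mul_lt_mul_left this (by positivity)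

end Pair

/-- Polar data for a circle `γ` orthogonal to `C`: relative to the center of `C` and the direction
`φ`, the center of `γ` has argument `θ` and modulus `d`, and `t` is half the angle under which `γ`
is seen from there. -/
structure IsPolar (C : PlaneCircle) (φ : ℝ) (γ : PlaneCircle) (θ t d : ℝ) : Prop where
  neg_pi_lt : -π < θ
  le_pi : θ ≤ π
  pos : 0 < t
  lt : t < π / 2
  d_pos : 0 < d
  radius_left : C.radius = d * cos t
  radius_right : γ.radius = d * sin t
  fst : γ.center 0 - C.center 0 = d * cos (θ + φ)
  snd : γ.center 1 - C.center 1 = d * sin (θ + φ)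

theorem Orth.exists_isPolar {C γ : PlaneCircle} (h : Orth C γ) (hC : 0 < C.radius)
    (hγ : 0 < γ.radius) (φ : ℝ) : ∃ θ t d, IsPolar C φ γ θ t d := by
  have h' : (γ.center 0 - C.center 0) ^ 2 + (γ.center 1 - C.center 1) ^ 2 =
      C.radius ^ 2 + γ.radius ^ 2 := by
    unfold Orth at h
    rw [dist_sq_eq] at h
    linarith
  obtain ⟨θ, t, d, h1, h2, h3, h4, h5, h6, h7, h8, h9⟩ := exists_polar φ hC hγ h'
  exact ⟨θ, t, d, h1, h2, h3, h4, h5, h6, h7, h8, h9⟩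

namespace IsPolar

variable {C γ γ' : PlaneCircle} {φ θ t d θ' t' d' : ℝ}

theorem dist_sq (h : IsPolar C φ γ θ t d) (h' : IsPolar C φ γ' θ' t' d') :
    dist γ.center γ'.center ^ 2 = d ^ 2 + d' ^ 2 - 2 * d * d' * cos (θ - θ') := by
  have e : θ - θ' = (θ + φ) - (θ' + φ) := by ring
  rw [dist_sq_eq, e, cos_sub]
  have e0 : γ.center 0 - γ'.center 0 = d * cos (θ + φ) - d' * cos (θ' + φ) := by
    rw [← h.fst, ← h'.fst]; ring
  have e1 : γ.center 1 - γ'.center 1 = d * sin (θ + φ) - d' * sin (θ' + φ) := by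
    rw [← h.snd, ← h'.snd]; ring
  rw [e0, e1]
  linear_combination d ^ 2 * sin_sq_add_cos_sq (θ + φ) + d' ^ 2 * sin_sq_add_cos_sq (θ' + φ)

theorem radius_pos (h : IsPolar C φ γ θ t d) : 0 < γ.radius := by
  rw [h.radius_right]
  exact mul_pos h.d_pos (sin_pos_of_pos_of_lt_pi h.pos (by linarith [h.lt, pi_pos]))

theorem cos_of_orth (h : IsPolar C φ γ θ t d) (h' : IsPolar C φ γ' θ' t' d') (ho : Orth γ γ') :
    cos (θ - θ') = cos t * cos t' :=
  cos_sub_eq_of_orth h.d_pos h'.d_pos h.radius_left h'.radius_left h.radius_right h'.radius_right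
    (h.dist_sq h') ho

theorem cos_of_apart (h : IsPolar C φ γ θ t d) (h' : IsPolar C φ γ' θ' t' d') (ho : Apart γ γ') :
    cos (θ - θ') < cos (t + t') :=
  cos_sub_lt_of_apart h.d_pos h'.d_pos h.radius_left h'.radius_left h.radius_right h'.radius_right
    h.radius_pos h'.radius_pos (h.dist_sq h') ho

theorem cos_of_inside (h : IsPolar C φ γ θ t d) (h' : IsPolar C φ γ' θ' t' d')
    (ho : Inside γ γ') : cos (t' - t) < cos (θ - θ') :=
  lt_cos_sub_of_inside h.d_pos h'.d_pos h.radius_left h'.radius_left h.radius_right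
    h'.radius_right dist_nonneg (h.dist_sq h') ho

theorem pi_div_four_le (h : IsPolar C φ γ θ t d) (hr : C.radius ≤ γ.radius) : π / 4 ≤ t := by
  by_contra! hlt
  rw [h.radius_left, h.radius_right] at hr
  have h1 : cos t ≤ sin t := le_of_mul_le_mul_left hr h.d_pos
  have h2 : cos (π / 4) < cos t := cos_lt_cos_of_nonneg_of_le_pi h.pos.le (by linarith [pi_pos]) hlt
  have h3 : sin t < sin (π / 4) :=
    sin_lt_sin_of_lt_of_le_pi_div_two (by linarith [pi_pos, h.pos]) (by linarith [pi_pos]) hlt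
  rw [cos_pi_div_four] at h2
  rw [sin_pi_div_four] at h3
  linarith

end IsPolar

theorem lt_abs_of_cos_lt_cos {a x : ℝ} (ha : a ≤ π) (h : cos x < cos a) :
    a < |x| := by
  by_contra! hle
  rw [← cos_abs x] at h
  exact absurd (cos_le_cos_of_nonneg_of_le_pi (abs_nonneg x) ha hle) (not_le.2 h)

theorem le_abs_of_cos_le_cos {a x : ℝ} (ha : a ≤ π) (h : cos x ≤ cos a) :
    a ≤ |x| := by
  by_contra! hle
  rw [← cos_abs x] at h
  exact absurd (cos_lt_cos_of_nonneg_of_le_pi (abs_nonneg x) ha hle) (not_lt.2 h)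

theorem abs_lt_of_cos_lt {a x : ℝ} (ha : 0 ≤ a) (hx : |x| ≤ π) (h : cos a < cos x) :
    |x| < a := by
  by_contra! hle
  rw [← cos_abs x] at h
  exact absurd (cos_le_cos_of_nonneg_of_le_pi ha hx hle) (not_le.2 h)

theorem cos_le_of_pi_div_four_le {t : ℝ} (h : π / 4 ≤ t) (h' : t < π / 2) : cos t ≤ √2 / 2 := by
  rw [← cos_pi_div_four]
  exact cos_le_cos_of_nonneg_of_le_pi (by linarith [pi_pos]) (by linarith [pi_pos]) h

/-- Both half-angles are at least π/4. Orthogonality then gives at most `(√2/2)²`, and separation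
gives a negative cosine because the half-angles add up to at least π/2. -/
theorem cos_sub_le_half_of_isPolar {C γ γ' : PlaneCircle} {φ θ t d θ' t' d' : ℝ}
    (h : IsPolar C φ γ θ t d) (h' : IsPolar C φ γ' θ' t' d') (hr : C.radius ≤ γ.radius)
    (hr' : C.radius ≤ γ'.radius) (ho : Orth γ γ' ∨ Apart γ γ') : cos (θ - θ') ≤ 1 / 2 := by
  have hpi := pi_pos
  have ht := h.pi_div_four_le hr
  have ht' := h'.pi_div_four_le hr'
  rcases ho with ho | ho
  · rw [h.cos_of_orth h' ho]
    have h1 := cos_le_of_pi_div_four_le ht h.lt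
    have h2 := cos_le_of_pi_div_four_le ht' h'.lt
    have h3 : 0 ≤ cos t' := cos_nonneg_of_neg_pi_div_two_le_of_le (by linarith) h'.lt.le
    calc cos t * cos t' ≤ √2 / 2 * (√2 / 2) := by gcongr
      _ = 1 / 2 := by
        rw [div_mul_div_comm, Real.mul_self_sqrt (by norm_num)]; norm_num
  · have h1 : cos (t + t') ≤ 0 :=
      cos_nonpos_of_pi_div_two_le_of_le (by linarith) (by linarith [h.lt, h'.lt])
    linarith [h.cos_of_apart h' ho]

/-! ### Counting petals by angular sectors -/

/-- Pigeonhole: `κ` numbers the sectors, and angles at least π/3 apart cannot share a sector in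
which all differences are below π/3. -/
theorem card_le_of_sectors {ι : Type*} {T : Finset ι} {θ : ι → ℝ} {k : ℕ} (κ : ℝ → ℕ)
    (hT : ∀ i ∈ T, ∀ j ∈ T, i ≠ j → cos (θ i - θ j) ≤ 1 / 2) (hκ : ∀ i ∈ T, κ (θ i) < k)
    (hsec : ∀ i ∈ T, ∀ j ∈ T, κ (θ i) = κ (θ j) → θ i - θ j < π / 3) :
    T.card ≤ k := by
  rw [← Finset.card_range k]
  apply Finset.card_le_card_of_injOn (fun i => κ (θ i))
  · intro i hi
    simpa using hκ i hi
  · intro i hi j hj hij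
    by_contra hne
    have h1 := le_abs_of_cos_le_cos (by linarith [pi_pos])
      ((hT i hi j hj hne).trans_eq cos_pi_div_three.symm)
    have h2 := hsec i hi j hj hij
    have h3 := hsec j hj i hi hij.symm
    have : |θ i - θ j| < π / 3 := abs_lt.2 ⟨by linarith, h2⟩
    linarith

theorem exists_polar_family {C : PlaneCircle} {T : Finset PlaneCircle} (hC : 0 < C.radius)
    (hT : ∀ γ ∈ T, Orth C γ ∧ C.radius ≤ γ.radius) (φ : ℝ) :
    ∃ θ t d : PlaneCircle → ℝ, ∀ γ ∈ T, IsPolar C φ γ (θ γ) (t γ) (d γ) := by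
  have : ∀ γ, ∃ θ t d, γ ∈ T → IsPolar C φ γ θ t d := by
    intro γ
    by_cases hγ : γ ∈ T
    · obtain ⟨θ, t, d, h⟩ := (hT γ hγ).1.exists_isPolar hC (hC.trans_le (hT γ hγ).2) φ
      exact ⟨θ, t, d, fun _ => h⟩
    · exact ⟨0, 0, 0, fun h => absurd h hγ⟩
  choose θ t d h using this
  exact ⟨θ, t, d, h⟩

/-- Circles that are orthogonal to `C`, at least as large as `C`, and not nested in each other. -/
structure IsFlower (C : PlaneCircle) (T : Finset PlaneCircle) : Prop where
  radius_pos : 0 < C.radius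
  orth : ∀ γ ∈ T, Orth C γ ∧ C.radius ≤ γ.radius
  pair : ∀ γ ∈ T, ∀ γ' ∈ T, γ ≠ γ' → Orth γ γ' ∨ Apart γ γ'

theorem IsFlower.card_le_six {C : PlaneCircle} {T : Finset PlaneCircle} (h : IsFlower C T) :
    T.card ≤ 6 := by
  obtain ⟨θ, t, d, hp⟩ := exists_polar_family h.radius_pos h.orth 0
  have hpi := pi_pos
  refine card_le_of_sectors (θ := θ) (fun x => if x ≤ -(2 * π / 3) then 0
    else if x ≤ -(π / 3) then 1 else if x ≤ 0 then 2 else if x ≤ π / 3 then 3 else if x ≤ 2 * π / 3 then 4 else 5) ?_ ?_ ?_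
  · intro γ hγ γ' hγ' hne
    exact cos_sub_le_half_of_isPolar (hp γ hγ) (hp γ' hγ') (h.orth γ hγ).2 (h.orth γ' hγ').2
      (h.pair γ hγ γ' hγ' hne)
  · intro γ _
    split_ifs <;> norm_num
  · intro γ hγ γ' hγ' heq
    have h1 := (hp γ hγ).neg_pi_lt
    have h2 := (hp γ' hγ').neg_pi_lt
    have h3 := (hp γ hγ).le_pi
    have h4 := (hp γ' hγ').le_pi
    split_ifs at heq <;> first | (exfalso; omega) | linarith

/-- The position of a petal of a flower relative to a further circle orthogonal to `C`. -/
theorem IsFlower.abs_cases {C β γ : PlaneCircle} {φ s t θ d e : ℝ} (hr : C.radius ≤ γ.radius)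
    (hβ : IsPolar C φ β 0 t e) (hγ : IsPolar C φ γ θ s d)
    (ho : Orth γ β ∨ Apart γ β ∨ Inside γ β) :
    (t < π / 4 → π / 4 ≤ |θ|) ∧
    (π / 4 ≤ t → (|θ| < t - π / 4) ∨ (π / 3 ≤ |θ| ∧ |θ| < π / 2 ∧ (π / 4 < t → π / 3 < |θ|)) ∨
      π / 4 + t < |θ|) := by
  have hs := hγ.pi_div_four_le hr
  have hpi := pi_pos
  have hθ : |θ| ≤ π := abs_le.2 ⟨hγ.neg_pi_lt.le, hγ.le_pi⟩
  have hs2 := hγ.lt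
  have ht2 := hβ.lt
  have ht0 := hβ.pos
  have hcs : 0 < cos s := cos_pos_of_mem_Ioo ⟨by linarith, hs2⟩
  have hct : 0 < cos t := cos_pos_of_mem_Ioo ⟨by linarith, ht2⟩
  have hcs' := cos_le_of_pi_div_four_le hs hs2
  have hsq : √2 / 2 * (√2 / 2) = 1 / 2 := by
    rw [div_mul_div_comm, Real.mul_self_sqrt (by norm_num)]; norm_num
  have hs2pos : 0 < √2 / 2 := by positivity
  rcases ho with ho | ho | ho
  · have hc := hγ.cos_of_orth hβ ho
    rw [sub_zero] at hc
    have h4 : π / 4 ≤ |θ| := by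
      apply le_abs_of_cos_le_cos (by linarith)
      rw [hc, cos_pi_div_four]
      calc cos s * cos t ≤ √2 / 2 * 1 := by gcongr; exact cos_le_one t
        _ = _ := mul_one _
    refine ⟨fun _ => h4, fun ht => Or.inr (Or.inl ⟨?_, ?_, fun ht' => ?_⟩)⟩
    · apply le_abs_of_cos_le_cos (by linarith)
      rw [hc, cos_pi_div_three, ← hsq]
      have := cos_le_of_pi_div_four_le ht ht2
      gcongr
    · apply abs_lt_of_cos_lt (by linarith) hθ
      rw [cos_pi_div_two, hc]
      positivity
    · apply lt_abs_of_cos_lt_cos (by linarith)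
      rw [hc, cos_pi_div_three, ← hsq]
      have : cos t < √2 / 2 := by
        rw [← cos_pi_div_four]
        exact cos_lt_cos_of_nonneg_of_le_pi (by linarith) (by linarith) ht'
      exact mul_lt_mul' hcs' this hct.le hs2pos
  · have hc := hγ.cos_of_apart hβ ho
    rw [sub_zero] at hc
    have := lt_abs_of_cos_lt_cos (by linarith) hc
    exact ⟨fun _ => by linarith, fun _ => Or.inr (Or.inr (by linarith))⟩
  · have hc := hγ.cos_of_inside hβ ho
    rw [sub_zero] at hc
    -- Both circles have the same `d cos s = e cos t`, the radius of `C`, so the smaller radius goes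
    -- with the smaller half-angle.
    have hlt : s < t := by
      have h1 : γ.radius < β.radius := by
        have : dist γ.center β.center < β.radius - γ.radius := ho
        linarith [dist_nonneg (x := γ.center) (y := β.center)]
      by_contra! hle
      have h2 : cos s ≤ cos t := cos_le_cos_of_nonneg_of_le_pi ht0.le (by linarith) hle
      have h3 : sin t ≤ sin s := sin_le_sin_of_le_of_le_pi_div_two (by linarith) hs2.le hle
      have h4 := hγ.radius_left
      have h5 := hβ.radius_left
      rw [hγ.radius_right, hβ.radius_right] at h1
      have hst : 0 < sin t := sin_pos_of_pos_of_lt_pi ht0 (by linarith)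
      have h6 : d < e := by
        by_contra! hed
        have : e * sin t ≤ d * sin s := mul_le_mul hed h3 hst.le hγ.d_pos.le
        linarith
      have : d * cos s < e * cos t := mul_lt_mul h6 h2 hcs hβ.d_pos.le
      linarith
    have := abs_lt_of_cos_lt (by linarith) hθ hc
    exact ⟨fun ht => by linarith, fun _ => Or.inl (by linarith)⟩

/-- The circle `β` leaves forbidden gaps among the directions of the petals. In each of three ranges
of its half-angle `t`, the remaining directions fit into five sectors of width at most π/3. -/
theorem IsFlower.card_le_five {C β : PlaneCircle} {T : Finset PlaneCircle} (h : IsFlower C T)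
    (hβ : Orth C β) (hβr : 0 < β.radius)
    (hTβ : ∀ γ ∈ T, Orth γ β ∨ Apart γ β ∨ Inside γ β) : T.card ≤ 5 := by
  obtain ⟨φ, e, t, hβp⟩ : ∃ φ e t, IsPolar C φ β 0 t e := by
    obtain ⟨θ, t, e, hp⟩ := hβ.exists_isPolar h.radius_pos hβr 0
    refine ⟨θ, e, t, ?_⟩
    have := hp
    rcases this with ⟨h1, h2, h3, h4, h5, h6, h7, h8, h9⟩
    exact ⟨by linarith [pi_pos], pi_pos.le, h3, h4, h5, h6, h7, by rwa [zero_add, ← add_zero θ],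
      by rwa [zero_add, ← add_zero θ]⟩
  obtain ⟨θ, s, d, hp⟩ := exists_polar_family h.radius_pos h.orth φ
  have hpi := pi_pos
  have hcase := fun γ hγ => IsFlower.abs_cases (h.orth γ hγ).2 hβp (hp γ hγ) (hTβ γ hγ)
  -- `ϑ c` is the representative of the angle in `[-c, 2π - c)`; the cut is chosen in each case to
  -- fall in a gap.
  obtain ⟨ϑ, hϑ⟩ : ∃ ϑ : ℝ → PlaneCircle → ℝ,
      ∀ c γ, ϑ c γ = if θ γ < -c then θ γ + 2 * π else θ γ := ⟨_, fun _ _ => rfl⟩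
  have hsep : ∀ c, ∀ γ ∈ T, ∀ γ' ∈ T, γ ≠ γ' → cos (ϑ c γ - ϑ c γ') ≤ 1 / 2 := by
    intro c γ hγ γ' hγ' hne
    have key := cos_sub_le_half_of_isPolar (hp γ hγ) (hp γ' hγ') (h.orth γ hγ).2 (h.orth γ' hγ').2
      (h.pair γ hγ γ' hγ' hne)
    rw [hϑ, hϑ]
    split_ifs
    · rwa [add_sub_add_right_eq_sub]
    · rwa [add_sub_right_comm, cos_add_two_pi]
    · rwa [← sub_sub, cos_sub_two_pi]
    · exact key
  rcases le_or_gt t (π / 4) with ht | ht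
  · have hb : ∀ γ ∈ T, π / 4 ≤ ϑ 0 γ ∧ ϑ 0 γ ≤ 7 * (π / 4) := by
      intro γ hγ
      have h1 : π / 4 ≤ |θ γ| := by
        rcases ht.lt_or_eq with ht | ht
        · exact (hcase γ hγ).1 ht
        · rcases (hcase γ hγ).2 ht.ge with h | h | h <;> linarith [abs_nonneg (θ γ)]
      have h2 := (hp γ hγ).neg_pi_lt
      have h3 := (hp γ hγ).le_pi
      rw [hϑ]
      rcases le_abs.1 h1 with h1 | h1 <;> split_ifs <;> constructor <;> linarith
    refine card_le_of_sectors (fun x => if x < π / 4 + π / 3 then 0 else if x < π / 4 + 2 * (π / 3)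
      then 1 else if x < π / 4 + 3 * (π / 3) then 2 else if x < π / 4 + 4 * (π / 3) then 3 else 4)
      (hsep 0) ?_ ?_
    · intro γ _
      split_ifs <;> norm_num
    · intro γ hγ γ' hγ' heq
      have h1 := hb γ hγ
      have h2 := hb γ' hγ'
      split_ifs at heq <;> first | (exfalso; omega) | linarith
  -- At `5π/12` the bound `t - π/4` equals π/6 and the bound `t + π/4` equals 2π/3. Below it the
  -- allowed arcs have widths π/3 and 4π/3, giving 1 + 4 sectors; from it on, π and 2π/3, giving 3 +
  -- 2.
  rcases lt_or_ge t (5 * (π / 12)) with ht' | ht'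
  · have hb : ∀ γ ∈ T, (-(π / 6) < ϑ (π / 4) γ ∧ ϑ (π / 4) γ < π / 6) ∨
        (π / 3 < ϑ (π / 4) γ ∧ ϑ (π / 4) γ < 5 * (π / 3)) := by
      intro γ hγ
      have h2 := (hp γ hγ).neg_pi_lt
      have h3 := (hp γ hγ).le_pi
      rw [hϑ]
      have h1 : |θ γ| < π / 6 ∨ π / 3 < |θ γ| := by
        rcases (hcase γ hγ).2 ht.le with h | h | h
        · left; linarith
        · right; exact h.2.2 ht
        · right; linarith
      rcases h1 with h1 | h1
      · rw [abs_lt] at h1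
        left
        split_ifs <;> constructor <;> linarith
      · right
        rcases lt_abs.1 h1 with h1 | h1 <;> split_ifs <;> constructor <;> linarith
    refine card_le_of_sectors (fun x => if x ≤ π / 3 then 0 else if x ≤ 2 * (π / 3) then 1
      else if x ≤ 3 * (π / 3) then 2 else if x ≤ 4 * (π / 3) then 3 else 4) (hsep (π / 4)) ?_ ?_
    · intro γ _
      split_ifs <;> norm_num
    · intro γ hγ γ' hγ' heq
      have h1 := hb γ hγ
      have h2 := hb γ' hγ'
      split_ifs at heq <;> first
        | (exfalso; omega)
        | (rcases h1 with h1 | h1 <;> rcases h2 with h2 | h2 <;> linarith)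
  · have hb : ∀ γ ∈ T, (-(π / 2) < ϑ (π / 2) γ ∧ ϑ (π / 2) γ < π / 2) ∨
        (2 * (π / 3) < ϑ (π / 2) γ ∧ ϑ (π / 2) γ < 4 * (π / 3)) := by
      intro γ hγ
      have h2 := (hp γ hγ).neg_pi_lt
      have h3 := (hp γ hγ).le_pi
      have h4 := hβp.lt
      rw [hϑ]
      have h1 : |θ γ| < π / 2 ∨ 2 * (π / 3) < |θ γ| := by
        rcases (hcase γ hγ).2 ht.le with h | h | h
        · left; linarith
        · left; exact h.2.1
        · right; linarith
      rcases h1 with h1 | h1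
      · rw [abs_lt] at h1
        left
        split_ifs <;> constructor <;> linarith
      · right
        rcases lt_abs.1 h1 with h1 | h1 <;> split_ifs <;> constructor <;> linarith
    refine card_le_of_sectors (fun x => if x < -(π / 6) then 0 else if x < π / 6 then 1
      else if x < π / 2 then 2 else if x < π then 3 else 4) (hsep (π / 2)) ?_ ?_
    · intro γ _
      split_ifs <;> norm_num
    · intro γ hγ γ' hγ' heq
      have h1 := hb γ hγ
      have h2 := hb γ' hγ'
      split_ifs at heq <;> first
        | (exfalso; omega)
        | (rcases h1 with h1 | h1 <;> rcases h2 with h2 | h2 <;> linarith)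

/-! ### A circle with at most seven orthogonal neighbors -/

theorem Inside.radius_lt {α β : PlaneCircle} (h : Inside α β) : α.radius < β.radius := by
  unfold Inside at h
  linarith [dist_nonneg (x := α.center) (y := β.center)]

theorem Orth.lt_dist {α β : PlaneCircle} (h : Orth α β) (hα : 0 < α.radius) (hβ : 0 < β.radius) :
    |α.radius - β.radius| < dist α.center β.center := by
  unfold Orth at h
  apply lt_of_pow_lt_pow_left₀ 2 dist_nonneg
  rw [h, sq_abs]
  nlinarith [mul_pos hα hβ]

theorem Orth.dist_lt {α β : PlaneCircle} (h : Orth α β) (hα : 0 < α.radius) (hβ : 0 < β.radius) :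
    dist α.center β.center < α.radius + β.radius := by
  unfold Orth at h
  apply lt_of_pow_lt_pow_left₀ 2 (by positivity)
  rw [h]
  nlinarith [mul_pos hα hβ]

/-- The circles `β` orthogonal to both `C` and `α`, where `C` lies inside `α`, form a pencil, in
which center and radius are given by a single real parameter. -/
theorem exists_pencil {C α : PlaneCircle} (hC : 0 < C.radius) (h : Inside C α) :
    ∃ (a M : ℝ) (Y : PlaneCircle → ℝ), 0 < M ∧ ∀ β, Orth C β → Orth α β →
      0 < a ∧ a * β.radius ^ 2 = M + Y β ^ 2 ∧
      ∀ β', Orth C β' → Orth α β' → a * dist β.center β'.center ^ 2 = (Y β - Y β') ^ 2 := by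
  unfold Inside at h
  have hd := dist_sq_eq C.center α.center
  have hd0 := dist_nonneg (x := C.center) (y := α.center)
  obtain ⟨D, hD⟩ : ∃ D, D = dist C.center α.center := ⟨_, rfl⟩
  obtain ⟨x, hx⟩ : ∃ x, x = α.center 0 - C.center 0 := ⟨_, rfl⟩
  obtain ⟨y, hy⟩ : ∃ y, y = α.center 1 - C.center 1 := ⟨_, rfl⟩
  rw [← hD] at h hd hd0
  have hd' : D ^ 2 = x ^ 2 + y ^ 2 := by rw [hd, hx, hy]; ring
  have hK : 2 * C.radius * D < α.radius ^ 2 - C.radius ^ 2 - D ^ 2 := by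
    have : (C.radius + D) ^ 2 < α.radius ^ 2 := by gcongr; linarith
    linarith
  -- The center of `β` lies on the radical axis of `C` and `α`. The parameter `Y` is position along
  -- that axis scaled by `D`, and `M > 0` says that the axis misses `C`. In the concentric case no
  -- `β` exists, which is why `0 < a` is only claimed once some `β` is given.
  have hlin : ∀ β, Orth C β → Orth α β →
      2 * (x * (β.center 0 - C.center 0) + y * (β.center 1 - C.center 1)) =
        -(α.radius ^ 2 - C.radius ^ 2 - D ^ 2) := by
    intro β h1 h2
    unfold Orth at h1 h2
    rw [dist_sq_eq] at h1 h2
    rw [hd', hx, hy]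
    linear_combination h1 - h2
  refine ⟨D ^ 2, ((α.radius ^ 2 - C.radius ^ 2 - D ^ 2) / 2) ^ 2 - (C.radius * D) ^ 2,
    fun β => x * (β.center 1 - C.center 1) - y * (β.center 0 - C.center 0), ?_, ?_⟩
  · rw [sub_pos]
    gcongr
    linarith
  · intro β h1 h2
    have hl := hlin β h1 h2
    refine ⟨?_, ?_, ?_⟩
    · rcases hd0.eq_or_lt with h0 | h0
      · rw [← h0] at hd' hK hl
        have hx0 : x = 0 := by nlinarith [sq_nonneg x, sq_nonneg y]
        have hy0 : y = 0 := by nlinarith [sq_nonneg x, sq_nonneg y]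
        rw [hx0, hy0] at hl
        linarith
      · positivity
    · unfold Orth at h1
      rw [dist_sq_eq] at h1
      obtain ⟨k, hk⟩ : ∃ k, k = α.radius ^ 2 - C.radius ^ 2 - D ^ 2 := ⟨_, rfl⟩
      rw [← hk] at hl ⊢
      have hkk : k ^ 2 =
          (2 * (x * (β.center 0 - C.center 0) + y * (β.center 1 - C.center 1))) ^ 2 := by
        rw [hl, neg_sq]
      linear_combination -D ^ 2 * h1 +
        ((β.center 0 - C.center 0) ^ 2 + (β.center 1 - C.center 1) ^ 2) * hd' - hkk / 4
    · intro β' h1' h2'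
      have hl' := hlin β' h1' h2'
      rw [dist_sq_eq, hd']
      have e : x * (β.center 0 - β'.center 0) + y * (β.center 1 - β'.center 1) = 0 := by
        linarith
      linear_combination (x * (β.center 0 - β'.center 0) + y * (β.center 1 - β'.center 1)) * e

/-- All circles orthogonal to both `C` and `α` pass through the two limit points of the pencil of
`C` and `α`, so any two of them cross, here orthogonally. In the parameter this reads `Y β * Y β' =
-M < 0`, and three reals cannot have pairwise negative products. -/
theorem card_orth_orth_le_two {A : Finset PlaneCircle} (hA : IsOrthogonalArrangement A)
    {C α : PlaneCircle} (hC : 0 < C.radius) (h : Inside C α) {T : Finset PlaneCircle} (hTA : T ⊆ A)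
    (hT : ∀ β ∈ T, Orth C β ∧ Orth α β) : T.card ≤ 2 := by
  obtain ⟨a, M, Y, hM, hY⟩ := exists_pencil hC h
  have hpair : ∀ β ∈ T, ∀ β' ∈ T, β ≠ β' → Y β * Y β' = -M := by
    intro β hβ β' hβ' hne
    have hr := hA.1 β (hTA hβ)
    have hr' := hA.1 β' (hTA hβ')
    obtain ⟨ha, h1, h2⟩ := hY β (hT β hβ).1 (hT β hβ).2
    obtain ⟨-, h1', -⟩ := hY β' (hT β' hβ').1 (hT β' hβ').2
    have h3 := h2 β' (hT β' hβ').1 (hT β' hβ').2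
    have hpos : |Y β * Y β'| < a * (β.radius * β'.radius) := by
      apply lt_of_pow_lt_pow_left₀ 2 (by positivity)
      rw [sq_abs]
      have : (a * (β.radius * β'.radius)) ^ 2 = (M + Y β ^ 2) * (M + Y β' ^ 2) := by
        rw [← h1, ← h1']; ring
      rw [this]
      nlinarith [mul_nonneg hM.le (sq_nonneg (Y β)), mul_nonneg hM.le (sq_nonneg (Y β')),
        mul_pos hM hM]
    rw [abs_lt] at hpos
    rcases hA.trichotomy (hTA hβ) (hTA hβ') hne with ho | ho | ho | ho
    · unfold Orth at ho
      rw [ho] at h3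
      linarith
    · unfold Apart at ho
      have : (β.radius + β'.radius) ^ 2 < dist β.center β'.center ^ 2 := by gcongr
      have := mul_lt_mul_of_pos_left this ha
      nlinarith
    · unfold Inside at ho
      have : dist β.center β'.center ^ 2 < (β'.radius - β.radius) ^ 2 := by gcongr
      have := mul_lt_mul_of_pos_left this ha
      nlinarith
    · unfold Inside at ho
      rw [dist_comm] at ho
      have : dist β.center β'.center ^ 2 < (β.radius - β'.radius) ^ 2 := by gcongr
      have := mul_lt_mul_of_pos_left this ha
      nlinarith
  by_contra! hcard
  obtain ⟨x, hx, y, hy, z, hz, hxy, hxz, hyz⟩ := Finset.two_lt_card.1 hcard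
  have h1 := hpair x hx y hy hxy
  have h2 := hpair x hx z hz hxz
  have h3 := hpair y hy z hz hyz
  have : (Y x * Y y * Y z) ^ 2 = -M ^ 3 := by
    calc _ = (Y x * Y y) * (Y x * Y z) * (Y y * Y z) := by ring
      _ = _ := by rw [h1, h2, h3]; ring
  nlinarith [sq_nonneg (Y x * Y y * Y z), pow_pos hM 3]

open Classical in
/-- Every nonempty arrangement of orthogonal circles has a circle that is orthogonal to at most
seven others. -/
theorem IsOrthogonalArrangement.exists_card_orth_le {A : Finset PlaneCircle}
    (hA : IsOrthogonalArrangement A) (hne : A.Nonempty) :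
    ∃ C ∈ A, (A.filter fun δ => Orth C δ).card ≤ 7 := by
  have hself : ∀ C ∈ A, ¬ Orth C C := by
    intro C hC h
    unfold Orth at h
    rw [dist_self] at h
    nlinarith [pow_pos (hA.1 C hC) 2]
  by_cases hnest : ∃ α ∈ A, ∃ C ∈ A, Inside C α
  · have hne' : (A.filter fun α => ∃ C ∈ A, Inside C α).Nonempty := by
      obtain ⟨α, hα, h⟩ := hnest
      exact ⟨α, Finset.mem_filter.2 ⟨hα, h⟩⟩
    obtain ⟨α, hα, hαmin⟩ := Finset.exists_min_image _ (fun α => α.radius) hne'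
    obtain ⟨hαA, C₀, hC₀, hC₀α⟩ := Finset.mem_filter.1 hα
    have hne'' : (A.filter fun C => Inside C α).Nonempty :=
      ⟨C₀, Finset.mem_filter.2 ⟨hC₀, hC₀α⟩⟩
    obtain ⟨C, hC, hCmin⟩ := Finset.exists_min_image _ (fun C => C.radius) hne''
    obtain ⟨hCA, hCα⟩ := Finset.mem_filter.1 hC
    have hCr := hA.1 C hCA
    have hαr := hA.1 α hαA
    -- A circle inside `α` that contained another would be a smaller choice for `α`.
    have hleaf : ∀ γ ∈ A, Inside γ α → ∀ δ ∈ A, ¬ Inside δ γ := fun γ hγ hγα δ hδ hδγ =>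
      absurd (hαmin γ (Finset.mem_filter.2 ⟨hγ, δ, hδ, hδγ⟩)) (not_le.2 hγα.radius_lt)
    set N := A.filter fun δ => Orth C δ
    set T := N.filter fun δ => Inside δ α
    set B := N.filter fun δ => Orth α δ
    have hsub : N ⊆ T ∪ B := by
      intro δ hδ
      have hδ' := Finset.mem_filter.1 hδ
      have hδr := hA.1 δ hδ'.1
      have h1 := hδ'.2.lt_dist hCr hδr
      have h2 := hδ'.2.dist_lt hCr hδr
      rw [abs_lt] at h1
      have h3 : dist C.center α.center < α.radius - C.radius := hCα
      have hne : δ ≠ α := by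
        rintro rfl
        linarith
      rcases hA.trichotomy hδ'.1 hαA hne with h | h | h | h
      · exact Finset.mem_union_right _ (Finset.mem_filter.2 ⟨hδ, h.symm⟩)
      · unfold Apart at h
        linarith [dist_triangle_left δ.center α.center C.center]
      · exact Finset.mem_union_left _ (Finset.mem_filter.2 ⟨hδ, h⟩)
      · unfold Inside at h
        linarith [dist_triangle C.center α.center δ.center]
    have hTmem : ∀ γ ∈ T, γ ∈ A ∧ Orth C γ ∧ Inside γ α := by
      intro γ hγ
      have h1 := Finset.mem_filter.1 hγ
      have h2 := Finset.mem_filter.1 h1.1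
      exact ⟨h2.1, h2.2, h1.2⟩
    have hBmem : ∀ β ∈ B, β ∈ A ∧ Orth C β ∧ Orth α β := by
      intro γ hγ
      have h1 := Finset.mem_filter.1 hγ
      have h2 := Finset.mem_filter.1 h1.1
      exact ⟨h2.1, h2.2, h1.2⟩
    have hT : IsFlower C T := by
      refine ⟨hCr, fun γ hγ => ⟨(hTmem γ hγ).2.1, ?_⟩, fun γ hγ γ' hγ' hne => ?_⟩
      · exact hCmin γ (Finset.mem_filter.2 ⟨(hTmem γ hγ).1, (hTmem γ hγ).2.2⟩)
      · obtain ⟨h1, -, h2⟩ := hTmem γ hγ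
        obtain ⟨h1', -, h2'⟩ := hTmem γ' hγ'
        rcases hA.trichotomy h1 h1' hne with h | h | h | h
        · exact Or.inl h
        · exact Or.inr h
        · exact absurd h (hleaf γ' h1' h2' γ h1)
        · exact absurd h (hleaf γ h1 h2 γ' h1')
    refine ⟨C, hCA, ?_⟩
    change N.card ≤ 7
    have hcard := (Finset.card_le_card hsub).trans (Finset.card_union_le T B)
    rcases B.eq_empty_or_nonempty with hB | ⟨β, hβ⟩
    · rw [hB, Finset.card_empty] at hcard
      have := hT.card_le_six
      omega
    · obtain ⟨hβA, hβC, hβα⟩ := hBmem β hβ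
      have hβr := hA.1 β hβA
      have h5 : T.card ≤ 5 := by
        refine hT.card_le_five hβC hβr fun γ hγ => ?_
        obtain ⟨h1, -, h2⟩ := hTmem γ hγ
        have hne : γ ≠ β := by
          rintro rfl
          have := (abs_lt.1 (hβα.lt_dist hαr hβr)).2
          unfold Inside at h2
          rw [dist_comm] at h2
          linarith
        rcases hA.trichotomy h1 hβA hne with h | h | h | h
        · exact Or.inl h
        · exact Or.inr (Or.inl h)
        · exact Or.inr (Or.inr h)
        · exact absurd h (hleaf γ h1 h2 β hβA)
      have h2 : B.card ≤ 2 :=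
        card_orth_orth_le_two hA hCr hCα (fun β hβ => (hBmem β hβ).1) fun β hβ => (hBmem β hβ).2
      omega
  · push Not at hnest
    obtain ⟨C, hC, hCmin⟩ := Finset.exists_min_image A (fun C => C.radius) hne
    refine ⟨C, hC, ?_⟩
    have : IsFlower C (A.filter fun δ => Orth C δ) := by
      refine ⟨hA.1 C hC, fun γ hγ => ?_, fun γ hγ γ' hγ' hne => ?_⟩
      · have := Finset.mem_filter.1 hγ
        exact ⟨this.2, hCmin γ this.1⟩
      · have h1 := (Finset.mem_filter.1 hγ).1
        have h1' := (Finset.mem_filter.1 hγ').1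
        rcases hA.trichotomy h1 h1' hne with h | h | h | h
        · exact Or.inl h
        · exact Or.inr h
        · exact absurd h (hnest γ' h1' γ h1)
        · exact absurd h (hnest γ h1 γ' h1')
    exact this.card_le_six.trans (by norm_num)

/-! ### Components and locally constant functions -/

section LocConst

variable {X : Type*} [TopologicalSpace X]

/-- The locally constant real functions on `U`, extended by zero. -/
def locConst (U : Set X) : Submodule ℝ (X → ℝ) where
  carrier := {f | (∀ x ∉ U, f x = 0) ∧ ∀ x ∈ U, ∀ᶠ y in 𝓝 x, f y = f x}
  add_mem' := by
    rintro f g ⟨hf, hf'⟩ ⟨hg, hg'⟩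
    refine ⟨fun x hx => by simp [hf x hx, hg x hx], fun x hx => ?_⟩
    filter_upwards [hf' x hx, hg' x hx] with y h1 h2
    simp [h1, h2]
  zero_mem' := ⟨fun _ _ => rfl, fun _ _ => Eventually.of_forall fun _ => rfl⟩
  smul_mem' := by
    rintro a f ⟨hf, hf'⟩
    refine ⟨fun x hx => by simp [hf x hx], fun x hx => ?_⟩
    filter_upwards [hf' x hx] with y h1
    simp [h1]

theorem eq_of_isPreconnected {U S : Set X} {f : X → ℝ} (hf : f ∈ locConst U)
    (hS : IsPreconnected S) (hSU : S ⊆ U) {x y : X} (hx : x ∈ S) (hy : y ∈ S) : f x = f y := by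
  refine hS.induction₂' (fun x y => f x = f y) (fun x hx => ?_)
    (fun _ _ _ _ _ _ h1 h2 => h1.trans h2) hx hy
  filter_upwards [nhdsWithin_le_nhds (hf.2 x (hSU hx))] with y hy
  exact ⟨hy.symm, hy⟩

theorem indicator_component_mem_locConst [LocallyConnectedSpace X] {U : Set X} (hU : IsOpen U)
    (x : X) : (connectedComponentIn U x).indicator 1 ∈ locConst U := by
  refine ⟨fun y hy => Set.indicator_of_notMem (fun h => hy (connectedComponentIn_subset U x h)) _,
    fun y hy => ?_⟩
  filter_upwards [(hU.connectedComponentIn (x := y)).mem_nhds (mem_connectedComponentIn hy)] with z hz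
  have h1 := connectedComponentIn_eq hz
  have : z ∈ connectedComponentIn U x ↔ y ∈ connectedComponentIn U x := by
    constructor <;> intro h
    · rw [connectedComponentIn_eq h, ← h1]
      exact mem_connectedComponentIn hy
    · rw [connectedComponentIn_eq h]
      exact hz
  by_cases h : y ∈ connectedComponentIn U x
  · rw [Set.indicator_of_mem h, Set.indicator_of_mem (this.2 h)]; rfl
  · rw [Set.indicator_of_notMem h, Set.indicator_of_notMem fun h' => h (this.1 h')]

/-- Evaluating a linear relation between indicators of components at a point of one of them isolates
its coefficient, so the indicators are independent. -/
theorem finite_components_of_rank_le [LocallyConnectedSpace X] {U : Set X} (hU : IsOpen U) {N : ℕ}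
    (hN : Module.rank ℝ (locConst U) ≤ N) :
    {F | ∃ x ∈ U, F = connectedComponentIn U x}.Finite ∧
      {F | ∃ x ∈ U, F = connectedComponentIn U x}.ncard ≤ N := by
  set K := {F | ∃ x ∈ U, F = connectedComponentIn U x}
  have hmem : ∀ F : K, (F : Set X).indicator 1 ∈ locConst U := by
    rintro ⟨F, x, hx, rfl⟩
    exact indicator_component_mem_locConst hU x
  have hli : LinearIndependent ℝ (fun F : K => (⟨_, hmem F⟩ : locConst U)) := by
    rw [linearIndependent_iff']
    rintro s g hg ⟨F, x, hx, rfl⟩ hF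
    have := congrFun (congrArg Subtype.val hg) x
    simp only [AddSubmonoidClass.coe_finsetSum, Finset.sum_apply, Submodule.coe_smul,
      Pi.smul_apply, ZeroMemClass.coe_zero, Pi.zero_apply] at this
    rw [Finset.sum_eq_single_of_mem _ hF] at this
    · simpa [Set.indicator_of_mem (mem_connectedComponentIn hx)] using this
    · rintro ⟨F', x', hx', rfl⟩ _ hne
      rw [Set.indicator_of_notMem, smul_zero]
      intro h
      exact hne (Subtype.ext (connectedComponentIn_eq h))
  have hcard : Cardinal.mk K ≤ N := by
    have := hli.cardinal_lift_le_rank.trans (Cardinal.lift_le.2 hN)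
    simpa using this
  have hfin : K.Finite := Cardinal.lt_aleph0_iff_set_finite.1
    (hcard.trans_lt (Cardinal.natCast_lt_aleph0))
  refine ⟨hfin, ?_⟩
  rw [← Set.cast_ncard hfin] at hcard
  exact_mod_cast hcard

theorem rank_locConst_univ_le [PreconnectedSpace X] :
    Module.rank ℝ (locConst (Set.univ : Set X)) ≤ 1 := by
  rcases isEmpty_or_nonempty X with h | ⟨⟨x⟩⟩
  · rw [rank_subsingleton']
    simp
  · refine (LinearMap.lift_rank_le_of_injective
      ((LinearMap.proj x).comp (locConst Set.univ).subtype) ?_) |> fun h => by simpa using h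
    intro f g hfg
    ext y
    rw [eq_of_isPreconnected f.2 isPreconnected_univ subset_rfl (Set.mem_univ y) (Set.mem_univ x),
      eq_of_isPreconnected g.2 isPreconnected_univ subset_rfl (Set.mem_univ y) (Set.mem_univ x)]
    exact hfg

end LocConst

/-! ### Removing a sphere from an open set -/

section Sphere

variable {E : Type*} [NormedAddCommGroup E] [NormedSpace ℝ E]

/-- The map `φ` sends `(x, s)` to the point at distance `s` from `c` in the direction of `x`. The
two sides are images of the convex halves `s < r` and `s > r` of a small box around `(p, r)`. -/
theorem exists_preconnected_sides {c p : E} {r : ℝ} (hr : 0 < r) (hp : dist p c = r) {U : Set E}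
    (hU : U ∈ 𝓝 p) : ∃ V W : Set E, IsPreconnected V ∧ IsPreconnected W ∧
      V ⊆ U \ Metric.sphere c r ∧ W ⊆ U \ Metric.sphere c r ∧
      ∀ᶠ x in 𝓝 p, (dist x c < r → x ∈ V) ∧ (r < dist x c → x ∈ W) := by
  set φ : E × ℝ → E := fun v => c + (v.2 / ‖v.1 - c‖) • (v.1 - c) with hφ
  have hpc : p ≠ c := by
    rintro rfl
    rw [dist_self] at hp
    exact hr.ne hp
  have hcont : ∀ v : E × ℝ, v.1 ≠ c → ContinuousAt φ v := by
    intro v hv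
    have : ‖v.1 - c‖ ≠ 0 := norm_ne_zero_iff.2 (sub_ne_zero.2 hv)
    fun_prop (disch := assumption)
  have hφself : ∀ x, x ≠ c → φ (x, dist x c) = x := by
    intro x hx
    have : ‖x - c‖ ≠ 0 := norm_ne_zero_iff.2 (sub_ne_zero.2 hx)
    simp [hφ, dist_eq_norm, div_self this]
  have hdist : ∀ v : E × ℝ, v.1 ≠ c → 0 < v.2 → dist (φ v) c = v.2 := by
    intro v hv hv2
    have : ‖v.1 - c‖ ≠ 0 := norm_ne_zero_iff.2 (sub_ne_zero.2 hv)
    rw [hφ, dist_eq_norm, add_sub_cancel_left, norm_smul, norm_div, norm_norm,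
      div_mul_cancel₀ _ this, norm_of_nonneg hv2.le]
  have hev : ∀ᶠ v in 𝓝 (p, r), φ v ∈ U ∧ v.1 ≠ c ∧ 0 < v.2 := by
    have h1 : φ (p, r) = p := by rw [← hp]; exact hφself p hpc
    refine ((hcont (p, r) hpc).eventually (by rwa [h1])).and (Eventually.and ?_ ?_)
    · exact continuousAt_fst.eventually_ne hpc
    · exact continuousAt_snd.eventually (lt_mem_nhds hr)
  obtain ⟨ε, hε, hball⟩ := Metric.eventually_nhds_iff_ball.1 hev
  rw [← ball_prod_same] at hball
  have himage : ∀ J : Set ℝ, Convex ℝ J →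
      IsPreconnected (φ '' (Metric.ball p ε ×ˢ (Metric.ball r ε ∩ J))) := by
    intro J hJ
    apply IsPreconnected.image
    · exact ((convex_ball p ε).isPreconnected).prod ((convex_ball r ε).inter hJ).isPreconnected
    · rintro v ⟨hv1, hv2, -⟩
      exact (hcont v (hball v ⟨hv1, hv2⟩).2.1).continuousWithinAt
  have hsub : ∀ J : Set ℝ, r ∉ J →
      φ '' (Metric.ball p ε ×ˢ (Metric.ball r ε ∩ J)) ⊆ U \ Metric.sphere c r := by
    rintro J hJ _ ⟨v, ⟨hv1, hv2, hv3⟩, rfl⟩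
    obtain ⟨h1, h2, h3⟩ := hball v ⟨hv1, hv2⟩
    refine ⟨h1, fun h => hJ ?_⟩
    rw [Metric.mem_sphere, hdist v h2 h3] at h
    rwa [← h]
  refine ⟨_, _, himage _ (convex_Iio r), himage _ (convex_Ioi r), hsub _ (by simp),
    hsub _ (by simp), ?_⟩
  have hd : ∀ᶠ x in 𝓝 p, dist x c ∈ Metric.ball r ε := by
    have : ContinuousAt (fun x => dist x c) p := by fun_prop
    exact this (by beta_reduce; rw [hp]; exact Metric.ball_mem_nhds r hε)
  filter_upwards [hd, Metric.ball_mem_nhds p hε] with x hx1 hx2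
  have hxc : x ≠ c := (hball (x, r) ⟨hx2, Metric.mem_ball_self hε⟩).2.1
  exact ⟨fun h => ⟨(x, dist x c), ⟨hx2, hx1, h⟩, hφself x hxc⟩,
    fun h => ⟨(x, dist x c), ⟨hx2, hx1, h⟩, hφself x hxc⟩⟩

theorem neBot_nhdsWithin_ball {c p : E} {r : ℝ} (hr : 0 < r) (hp : dist p c = r) :
    (𝓝[Metric.ball c r] p).NeBot := by
  rw [← mem_closure_iff_nhdsWithin_neBot, closure_ball c hr.ne']
  exact hp.le

theorem neBot_nhdsWithin_compl_closedBall {c p : E} {r : ℝ} (hr : 0 < r) (hp : dist p c = r) :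
    (𝓝[(Metric.closedBall c r)ᶜ] p).NeBot := by
  rw [← mem_closure_iff_nhdsWithin_neBot, closure_compl, interior_closedBall c hr.ne']
  exact fun h => (Metric.mem_ball.1 h).ne hp

/-- The function `f` is constant near `p`, apart from its values on `S`. -/
def ExtendsAcross {X : Type*} [TopologicalSpace X] (S : Set X) (f : X → ℝ) (p : X) : Prop :=
  ∃ a, ∀ᶠ x in 𝓝 p, x ∉ S → f x = a

/-- Each side of the sphere near `p` is connected, so `f` takes one value on each; `x` and `y`
sample them, and do not depend on `f`. -/
theorem exists_test_points {c p : E} {r : ℝ} (hr : 0 < r) (hp : dist p c = r) {U : Set E}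
    (hU : U ∈ 𝓝 p) : ∃ x y : E, ∀ f ∈ locConst (U \ Metric.sphere c r),
      ∀ᶠ q in 𝓝[Metric.sphere c r] p, (ExtendsAcross (Metric.sphere c r) f q ↔ f x = f y) := by
  obtain ⟨V, W, hV, hW, hVU, hWU, hVW⟩ := exists_preconnected_sides hr hp hU
  obtain ⟨x, hx⟩ : V.Nonempty := by
    have := neBot_nhdsWithin_ball hr hp
    obtain ⟨x, h1, h2⟩ := ((hVW.filter_mono nhdsWithin_le_nhds).and
      (self_mem_nhdsWithin (s := Metric.ball c r))).exists
    exact ⟨x, h1.1 h2⟩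
  obtain ⟨y, hy⟩ : W.Nonempty := by
    have := neBot_nhdsWithin_compl_closedBall hr hp
    obtain ⟨x, h1, h2⟩ := ((hVW.filter_mono nhdsWithin_le_nhds).and
      (self_mem_nhdsWithin (s := (Metric.closedBall c r)ᶜ))).exists
    exact ⟨x, h1.2 (not_le.1 h2)⟩
  refine ⟨x, y, fun f hf => ?_⟩
  filter_upwards [nhdsWithin_le_nhds hVW.eventually_nhds, self_mem_nhdsWithin] with q hq hqS
  constructor
  · rintro ⟨a, ha⟩
    have hxa : f x = a := by
      have := neBot_nhdsWithin_ball hr hqS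
      obtain ⟨z, ⟨h1, h2⟩, h3⟩ := (((hq.and ha).filter_mono nhdsWithin_le_nhds).and
        (self_mem_nhdsWithin (s := Metric.ball c r))).exists
      rw [← h2 (fun h => (Metric.mem_ball.1 h3).ne h)]
      exact eq_of_isPreconnected hf hV hVU hx (h1.1 h3)
    have hya : f y = a := by
      have := neBot_nhdsWithin_compl_closedBall hr hqS
      obtain ⟨z, ⟨h1, h2⟩, h3⟩ := (((hq.and ha).filter_mono nhdsWithin_le_nhds).and
        (self_mem_nhdsWithin (s := (Metric.closedBall c r)ᶜ))).exists
      have h3' : r < dist z c := not_le.1 h3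
      rw [← h2 (fun h => h3'.ne' h)]
      exact eq_of_isPreconnected hf hW hWU hy (h1.2 h3')
    rw [hxa, hya]
  · intro hxy
    refine ⟨f x, ?_⟩
    filter_upwards [hq] with z hz hzS
    rcases lt_or_gt_of_ne hzS with h | h
    · exact eq_of_isPreconnected hf hV hVU (hz.1 h) hx
    · rw [hxy]
      exact eq_of_isPreconnected hf hW hWU (hz.2 h) hy

/-- Whether `f` extends across the sphere is locally constant along it within `U`, so on a connected
piece a single linear condition on `f` decides. -/
theorem exists_test_points_of_isPreconnected {c : E} {r : ℝ} (hr : 0 < r) {U P : Set E}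
    (hU : IsOpen U) (hP : IsPreconnected P) (hPU : P ⊆ U ∩ Metric.sphere c r) :
    ∃ x y : E, ∀ f ∈ locConst (U \ Metric.sphere c r), f x = f y →
      ∀ q ∈ P, ExtendsAcross (Metric.sphere c r) f q := by
  rcases P.eq_empty_or_nonempty with rfl | ⟨p, hp⟩
  · exact ⟨0, 0, by simp⟩
  obtain ⟨x, y, hxy⟩ := exists_test_points hr (hPU hp).2 (hU.mem_nhds (hPU hp).1)
  refine ⟨x, y, fun f hf hfxy q hq => ?_⟩
  have key := hP.induction₂' (fun a b => ExtendsAcross (Metric.sphere c r) f a ↔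
    ExtendsAcross (Metric.sphere c r) f b) (fun a ha => ?_) (fun _ _ _ _ _ _ h1 h2 => h1.trans h2)
    hp hq
  · exact key.1 (((hxy f hf).self_of_nhdsWithin (hPU hp).2).2 hfxy)
  · obtain ⟨x', y', h⟩ := exists_test_points hr (hPU ha).2 (hU.mem_nhds (hPU ha).1)
    have h0 := (h f hf).self_of_nhdsWithin (hPU ha).2
    filter_upwards [nhdsWithin_mono a (fun z hz => (hPU hz).2) (h f hf)] with b hb
    exact ⟨h0.trans hb.symm, hb.trans h0.symm⟩

theorem exists_extension {c : E} {r : ℝ} (hr : 0 < r) {U : Set E} (hU : IsOpen U) {f : E → ℝ}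
    (hf : f ∈ locConst (U \ Metric.sphere c r))
    (h : ∀ q ∈ U ∩ Metric.sphere c r, ExtendsAcross (Metric.sphere c r) f q) :
    ∃ g ∈ locConst U, (Metric.sphere c r)ᶜ.indicator g = f := by
  classical
  set S := Metric.sphere c r
  have hneBot : ∀ p ∈ S, (𝓝[Sᶜ] p).NeBot := by
    intro p hp
    have := neBot_nhdsWithin_ball hr hp
    refine NeBot.mono this (nhdsWithin_mono p fun x hx hxS => ?_)
    exact (Metric.mem_ball.1 hx).ne hxS
  choose! a ha using h
  have hfS : ∀ x ∈ S, f x = 0 := fun x hx => hf.1 x fun h => h.2 hx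
  refine ⟨fun x => if x ∈ U ∩ S then a x else f x, ⟨fun x hx => ?_, fun x hx => ?_⟩, ?_⟩ <;> beta_reduce
  · rw [if_neg fun h : x ∈ U ∩ S => hx h.1]
    exact hf.1 x fun h => hx h.1
  · by_cases hxS : x ∈ S
    · rw [if_pos (show x ∈ U ∩ S from ⟨hx, hxS⟩)]
      filter_upwards [(ha x ⟨hx, hxS⟩).eventually_nhds, ha x ⟨hx, hxS⟩,
        hU.mem_nhds hx] with y hy1 hy2 hyU
      split_ifs with hy
      -- The limit values at nearby points of the sphere agree, since points off the sphere
      -- accumulate at `y` and both values are read off there.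
      · have := hneBot y hy.2
        obtain ⟨z, ⟨h1, h2⟩, h3⟩ := (((hy1.and (ha y hy)).filter_mono nhdsWithin_le_nhds).and
          (self_mem_nhdsWithin (s := Sᶜ))).exists
        rw [← h1 h3, ← h2 h3]
      · exact hy2 fun hyS => hy ⟨hyU, hyS⟩
    · rw [if_neg fun h : x ∈ U ∩ S => hxS h.2]
      filter_upwards [hf.2 x ⟨hx, hxS⟩, Metric.isClosed_sphere.isOpen_compl.mem_nhds hxS]
        with y hy1 hy2
      rwa [if_neg fun h : y ∈ U ∩ S => hy2 h.2]
  · ext x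
    by_cases hxS : x ∈ S
    · rw [Set.indicator_of_notMem (fun h : x ∈ Sᶜ => h hxS), hfS x hxS]
    · rw [Set.indicator_of_mem (show x ∈ Sᶜ from hxS), if_neg fun h : x ∈ U ∩ S => hxS h.2]

/-- Rank-nullity for the map `J` recording the jump across each of the `k` pieces: its image has
dimension at most `k`, and a function without jumps is the restriction of one from `locConst U`. -/
theorem rank_locConst_diff_sphere_le {c : E} {r : ℝ} (hr : 0 < r) {U : Set E} (hU : IsOpen U)
    {k N : ℕ} {P : Fin k → Set E} (hP : ∀ i, IsPreconnected (P i))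
    (hPU : ⋃ i, P i = U ∩ Metric.sphere c r) (hN : Module.rank ℝ (locConst U) ≤ N) :
    Module.rank ℝ (locConst (U \ Metric.sphere c r)) ≤ (N + k : ℕ) := by
  have htest := fun i => exists_test_points_of_isPreconnected hr hU (hP i)
    ((Set.subset_iUnion P i).trans hPU.subset)
  choose x y hxy using htest
  set S := Metric.sphere c r
  let J : locConst (U \ S) →ₗ[ℝ] (Fin k → ℝ) :=
    (LinearMap.pi fun i => (LinearMap.proj (R := ℝ) (φ := fun _ : E => ℝ) (x i) -
      LinearMap.proj (R := ℝ) (φ := fun _ : E => ℝ) (y i))).comp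
      (locConst (U \ S)).subtype
  have hR : ∀ g ∈ locConst U, Sᶜ.indicator g ∈ locConst (U \ S) := by
    intro g hg
    refine ⟨fun z hz => ?_, fun z hz => ?_⟩
    · by_cases hzS : z ∈ S
      · exact Set.indicator_of_notMem (fun h : z ∈ Sᶜ => h hzS) _
      · rw [Set.indicator_of_mem (show z ∈ Sᶜ from hzS)]
        exact hg.1 z fun h => hz ⟨h, hzS⟩
    · filter_upwards [hg.2 z hz.1, Metric.isClosed_sphere.isOpen_compl.mem_nhds hz.2] with w h1 h2
      rw [Set.indicator_of_mem h2, Set.indicator_of_mem (show z ∈ Sᶜ from hz.2), h1]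
  let R : locConst U →ₗ[ℝ] locConst (U \ S) :=
    { toFun := fun g => ⟨Sᶜ.indicator g, hR g g.2⟩
      map_add' := fun g h => Subtype.ext (Set.indicator_add _ _ _)
      map_smul' := fun a g => Subtype.ext (Set.indicator_const_smul Sᶜ a (g : E → ℝ)) }
  have hker : LinearMap.ker J ≤ LinearMap.range R := by
    rintro ⟨f, hf⟩ hfJ
    have hfJ' : ∀ i, f (x i) = f (y i) := fun i => sub_eq_zero.1 (congrFun hfJ i)
    obtain ⟨g, hg, hgf⟩ := exists_extension hr hU hf fun q hq => by
      rw [← hPU] at hq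
      obtain ⟨i, hi⟩ := Set.mem_iUnion.1 hq
      exact hxy i f hf (hfJ' i) q hi
    exact ⟨⟨g, hg⟩, Subtype.ext hgf⟩
  rw [← Cardinal.lift_le.{0}, ← LinearMap.lift_rank_range_add_rank_ker J, add_comm]
  have h1 : Module.rank ℝ (LinearMap.range J) ≤ k :=
    (Submodule.rank_le _).trans (by rw [rank_fin_fun])
  have h2 := Cardinal.lift_le.2 (((Submodule.rank_mono hker).trans (rank_range_le R)).trans hN)
  refine (add_le_add h2 (Cardinal.lift_le.2 h1)).trans ?_
  simp

end Sphere

/-! ### Arcs of a circle in the plane -/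

/-- The argument of the point `p`, seen from `c`. -/
noncomputable def argAt (c p : Plane) : ℝ := Complex.arg ⟨p 0 - c 0, p 1 - c 1⟩

/-- The point of the circle of center `c` and radius `r` with argument `t`. -/
noncomputable def circlePoint (c : Plane) (r t : ℝ) : Plane :=
  !₂[c 0 + r * cos t, c 1 + r * sin t]

theorem continuous_circlePoint (c : Plane) (r : ℝ) : Continuous (circlePoint c r) := by
  unfold circlePoint
  refine (PiLp.continuous_toLp 2 _).comp (continuous_pi fun i => ?_)
  fin_cases i
  · simp; fun_prop
  · simp; fun_prop

theorem circlePoint_argAt {c p : Plane} {r : ℝ} (hr : 0 < r) (hp : dist p c = r) :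
    circlePoint c r (argAt c p) = p := by
  set z : ℂ := ⟨p 0 - c 0, p 1 - c 1⟩ with hz
  have hn : ‖z‖ = r := by
    rw [← sq_eq_sq₀ (norm_nonneg _) hr.le, ← Complex.normSq_eq_norm_sq, Complex.normSq_apply, ← hp,
      dist_sq_eq]
    simp only [hz]
    ring
  have h0 := Complex.norm_mul_cos_arg z
  have h1 := Complex.norm_mul_sin_arg z
  rw [hn] at h0 h1
  ext i
  fin_cases i
  · simp [circlePoint, argAt, ← hz, h0]
    simp [hz]
  · simp [circlePoint, argAt, ← hz, h1]
    simp [hz]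

theorem argAt_circlePoint {c : Plane} {r t : ℝ} (hr : 0 < r) (ht : t ∈ Set.Ioc (-π) π) :
    argAt c (circlePoint c r t) = t := by
  refine Eq.trans ?_ (Complex.arg_mul_cos_add_sin_mul_I hr ht)
  rw [argAt]
  congr 1
  apply Complex.ext
  · simp [circlePoint, ← Complex.ofReal_cos, ← Complex.ofReal_sin]
  · simp [circlePoint, ← Complex.ofReal_cos, ← Complex.ofReal_sin]

theorem dist_circlePoint {c : Plane} {r : ℝ} (hr : 0 < r) (t : ℝ) :
    dist (circlePoint c r t) c = r := by
  rw [← sq_eq_sq₀ dist_nonneg hr.le, dist_sq_eq]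
  simp [circlePoint]
  linear_combination r ^ 2 * sin_sq_add_cos_sq t

/-- A circle with `m` points removed is a union of `m + 1` connected arcs. -/
theorem exists_arcs {c : Plane} {r : ℝ} (hr : 0 < r) (Z : Finset Plane)
    (hZ : ∀ z ∈ Z, dist z c = r) {k : ℕ} (hk : Z.card < k) :
    ∃ P : Fin k → Set Plane, (∀ i, IsPreconnected (P i)) ∧
      ⋃ i, P i = Metric.sphere c r \ Z := by
  classical
  set B := Z.image (argAt c) with hB
  have hBc : B.card < k := Finset.card_image_le.trans_lt hk
  -- Angles are indexed by the number of removed angles below them. The cut of `(-π, π]` at π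
  -- accounts for the extra piece; some pieces may be empty.
  let I : Fin k → Set ℝ := fun i =>
    {t | t ∈ Set.Ioc (-π) π ∧ t ∉ B ∧ (B.filter (· < t)).card = i}
  refine ⟨fun i => circlePoint c r '' I i, fun i => ?_, ?_⟩
  · refine IsPreconnected.image ?_ _ (continuous_circlePoint c r).continuousOn
    apply Set.OrdConnected.isPreconnected
    refine ⟨?_⟩
    rintro t₁ ⟨h1, h1', h1''⟩ t₂ ⟨h2, h2', h2''⟩ s ⟨hs1, hs2⟩
    have hmono : ∀ {a b : ℝ}, a ≤ b → B.filter (· < a) ⊆ B.filter (· < b) := by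
      intro a b hab x hx
      rw [Finset.mem_filter] at hx ⊢
      exact ⟨hx.1, hx.2.trans_le hab⟩
    refine ⟨⟨h1.1.trans_le hs1, hs2.trans h2.2⟩, fun hs => ?_, ?_⟩
    · have h12 : B.filter (· < t₁) = B.filter (· < t₂) :=
        Finset.eq_of_subset_of_card_le (hmono (hs1.trans hs2)) (by omega)
      have hlt : s < t₂ := hs2.lt_of_ne fun h => h2' (h ▸ hs)
      have : s ∈ B.filter (· < t₁) := h12 ▸ Finset.mem_filter.2 ⟨hs, hlt⟩
      exact absurd (Finset.mem_filter.1 this).2 (not_lt.2 hs1)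
    · have h3 := Finset.card_le_card (hmono hs1)
      have h4 := Finset.card_le_card (hmono hs2)
      omega
  · ext p
    rw [Set.mem_iUnion]
    constructor
    · rintro ⟨i, t, ⟨ht, htB, -⟩, rfl⟩
      refine ⟨dist_circlePoint hr t, fun hz => htB ?_⟩
      rw [← argAt_circlePoint hr ht (c := c)]
      exact Finset.mem_image_of_mem _ hz
    · rintro ⟨hp, hpZ⟩
      have hp' : dist p c = r := hp
      refine ⟨⟨(B.filter (· < argAt c p)).card, (Finset.card_filter_le _ _).trans_lt hBc⟩,
        argAt c p, ⟨⟨Complex.neg_pi_lt_arg _, Complex.arg_le_pi _⟩, fun h => hpZ ?_, rfl⟩,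
        circlePoint_argAt hr hp'⟩
      obtain ⟨z, hz, hzp⟩ := Finset.mem_image.1 h
      have : z = p := by
        rw [← circlePoint_argAt hr hp', ← hzp, circlePoint_argAt hr (hZ z hz)]
      exact this ▸ hz

/-! ### Induction on the number of circles -/

theorem exists_card_le_two_of_orth {α β : PlaneCircle} (h : Orth α β) (hα : 0 < α.radius) :
    ∃ F : Finset Plane, F.card ≤ 2 ∧ ∀ p, p ∈ α → p ∈ β → p ∈ F := by
  classical
  by_cases h2 : ∃ p₁ p₂, p₁ ≠ p₂ ∧ (p₁ ∈ α ∧ p₁ ∈ β) ∧ p₂ ∈ α ∧ p₂ ∈ β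
  · obtain ⟨p₁, p₂, hne, ⟨h1, h1'⟩, h2, h2'⟩ := h2
    refine ⟨{p₁, p₂}, Finset.card_le_two, fun p hp hp' => ?_⟩
    have hc : α.center ≠ β.center := by
      intro hc
      unfold Orth at h
      rw [hc, dist_self] at h
      nlinarith [pow_pos hα 2, sq_nonneg β.radius]
    rw [Finset.mem_insert, Finset.mem_singleton]
    exact EuclideanGeometry.eq_of_dist_eq_of_dist_eq_of_finrank_eq_two (by simp) hc hne
      h1 h2 hp h1' h2' hp'
  · push Not at h2
    by_cases h1 : ∃ p, p ∈ α ∧ p ∈ β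
    · obtain ⟨p, hp, hp'⟩ := h1
      refine ⟨{p}, by simp, fun q hq hq' => ?_⟩
      rw [Finset.mem_singleton]
      by_contra hne
      exact h2 p q (Ne.symm hne) ⟨hp, hp'⟩ hq hq'
    · exact ⟨∅, by simp, fun p hp hp' => absurd ⟨p, hp, hp'⟩ h1⟩

open Classical in
/-- Some circle of the arrangement carries at most fourteen intersection points. -/
theorem IsOrthogonalArrangement.exists_few_points {A : Finset PlaneCircle}
    (hA : IsOrthogonalArrangement A) (hne : A.Nonempty) :
    ∃ C ∈ A, ∃ Z : Finset Plane, Z.card ≤ 14 ∧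
      ∀ p, p ∈ Z ↔ p ∈ C ∧ ∃ δ ∈ A.erase C, p ∈ δ := by
  obtain ⟨C, hC, hcard⟩ := hA.exists_card_orth_le hne
  refine ⟨C, hC, ?_⟩
  have hF : ∀ δ, ∃ F : Finset Plane, F.card ≤ 2 ∧ (Orth C δ → ∀ p, p ∈ C → p ∈ δ → p ∈ F) := by
    intro δ
    by_cases h : Orth C δ
    · obtain ⟨F, h1, h2⟩ := exists_card_le_two_of_orth h (hA.1 C hC)
      exact ⟨F, h1, fun _ => h2⟩
    · exact ⟨∅, by simp, fun h' => absurd h' h⟩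
  choose F hF2 hF using hF
  have hU : ((A.filter fun δ => Orth C δ).biUnion F).card ≤ 14 :=
    (Finset.card_biUnion_le_card_mul _ _ 2 fun δ _ => hF2 δ).trans (by omega)
  -- The sets `F δ` may contain points that are no intersections; filtering makes `Z` exact, so that
  -- `C` minus `Z` is precisely the part of `C` off the other circles.
  refine ⟨((A.filter fun δ => Orth C δ).biUnion F).filter fun p => p ∈ C ∧ ∃ δ ∈ A.erase C, p ∈ δ,
    (Finset.card_filter_le _ _).trans hU, fun p => ?_⟩
  rw [Finset.mem_filter, and_iff_right_iff_imp]
  rintro ⟨hpC, δ, hδ, hpδ⟩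
  obtain ⟨hne, hδA⟩ := Finset.mem_erase.1 hδ
  have ho := orth_of_mem (hA.2 C hC δ hδA hne.symm) hpC hpδ
  exact Finset.mem_biUnion.2 ⟨δ, Finset.mem_filter.2 ⟨hδA, ho⟩, hF δ ho p hpC hpδ⟩

theorem isOpen_complementOfCircles (A : Finset PlaneCircle) : IsOpen (complementOfCircles A) := by
  have : complementOfCircles A = ⋂ α ∈ A, (Metric.sphere α.center α.radius)ᶜ := by
    ext p
    simp only [Set.mem_iInter]
    rfl
  rw [this]
  exact isOpen_biInter_finset fun α _ => Metric.isClosed_sphere.isOpen_compl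

open Classical in
theorem complementOfCircles_eq_diff {A : Finset PlaneCircle} {C : PlaneCircle} (hC : C ∈ A) :
    complementOfCircles A =
      complementOfCircles (A.erase C) \ Metric.sphere C.center C.radius := by
  ext p
  constructor
  · intro h
    exact ⟨fun α hα => h α (Finset.mem_of_mem_erase hα), h C hC⟩
  · rintro ⟨h1, h2⟩ α hα
    by_cases hαC : α = C
    · rw [hαC]
      exact h2
    · exact h1 α (Finset.mem_erase.2 ⟨hαC, hα⟩)

theorem IsOrthogonalArrangement.bounds (n : ℕ) : ∀ A : Finset PlaneCircle, A.card = n →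
    IsOrthogonalArrangement A →
    ((intersectionPoints A).Finite ∧ (intersectionPoints A).ncard ≤ 14 * n) ∧
      Module.rank ℝ (locConst (complementOfCircles A)) ≤ (1 + 15 * n : ℕ) := by
  classical
  induction n with
  | zero =>
    intro A hcard _
    obtain rfl := Finset.card_eq_zero.1 hcard
    have h1 : intersectionPoints ∅ = ∅ := by
      ext p
      simp [intersectionPoints]
    have h2 : complementOfCircles ∅ = Set.univ := by
      ext p
      simp [complementOfCircles]
    rw [h1, h2]
    exact ⟨by simp, by simpa using rank_locConst_univ_le⟩
  | succ n ih =>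
    intro A hcard hA
    obtain ⟨C, hC, Z, hZ, hmem⟩ := hA.exists_few_points (Finset.card_pos.1 (by omega))
    have hA' : IsOrthogonalArrangement (A.erase C) :=
      ⟨fun α hα => hA.1 α (Finset.mem_of_mem_erase hα), fun α hα β hβ =>
        hA.2 α (Finset.mem_of_mem_erase hα) β (Finset.mem_of_mem_erase hβ)⟩
    obtain ⟨⟨hfin, hle⟩, hrank⟩ := ih _ (by rw [Finset.card_erase_of_mem hC]; omega) hA'
    have hsub : intersectionPoints A ⊆ intersectionPoints (A.erase C) ∪ Z := by
      rintro p ⟨α, hα, β, hβ, hne, hpα, hpβ⟩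
      by_cases h1 : α = C
      · subst h1
        exact Or.inr ((hmem p).2 ⟨hpα, β, Finset.mem_erase.2 ⟨hne.symm, hβ⟩, hpβ⟩)
      · by_cases h2 : β = C
        · subst h2
          exact Or.inr ((hmem p).2 ⟨hpβ, α, Finset.mem_erase.2 ⟨h1, hα⟩, hpα⟩)
        · exact Or.inl ⟨α, Finset.mem_erase.2 ⟨h1, hα⟩, β, Finset.mem_erase.2 ⟨h2, hβ⟩,
            hne, hpα, hpβ⟩
    have hfin' := hfin.union Z.finite_toSet
    refine ⟨⟨hfin'.subset hsub, ?_⟩, ?_⟩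
    · have h1 := Set.ncard_le_ncard hsub hfin'
      have h2 := Set.ncard_union_le (intersectionPoints (A.erase C)) (Z : Set Plane)
      rw [Set.ncard_coe_finset] at h2
      omega
    · have hr := hA.1 C hC
      -- Fifteen pieces: at most 14 removed points, plus one for the cut of the parameter interval.
      obtain ⟨P, hP, hPU⟩ := exists_arcs hr Z (fun z hz => ((hmem z).1 hz).1) (k := 15) (by omega)
      rw [complementOfCircles_eq_diff hC, show 1 + 15 * (n + 1) = 1 + 15 * n + 15 by ring]
      refine rank_locConst_diff_sphere_le hr (isOpen_complementOfCircles (A.erase C)) hP ?_ hrank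
      · rw [hPU]
        ext p
        constructor
        · rintro ⟨h1, h2⟩
          exact ⟨fun δ hδ hpδ => h2 ((hmem p).2 ⟨h1, δ, hδ, hpδ⟩), h1⟩
        · rintro ⟨h1, h2⟩
          refine ⟨h2, fun hpZ => ?_⟩
          obtain ⟨-, δ, hδ, hpδ⟩ := (hmem p).1 hpZ
          exact h1 δ hδ hpδ

end OrthogonalCircles

theorem theorem1 (n : ℕ) (A : Finset OrthogonalCircles.PlaneCircle) (hn : A.card = n)
    (hA : OrthogonalCircles.IsOrthogonalArrangement A) :
    ((OrthogonalCircles.intersectionPoints A).Finite ∧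
      (OrthogonalCircles.intersectionPoints A).ncard ≤ 14 * n) ∧
    ((OrthogonalCircles.faces A).Finite ∧
      (OrthogonalCircles.faces A).ncard ≤ 15 * n + 2) := by
  obtain ⟨h1, h2⟩ := OrthogonalCircles.IsOrthogonalArrangement.bounds n A hn hA
  obtain ⟨h3, h4⟩ := OrthogonalCircles.finite_components_of_rank_le
    (OrthogonalCircles.isOpen_complementOfCircles A) h2
  exact ⟨h1, h3, h4.trans (by omega)⟩
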